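/- For a positive integer $d$ let $$H_d = \langle a,b,c \mid a^2,\ b^2,\ c^2,\ (ab)^3,\ (ac)^2,\ (bc)^d,\ (bac)^d\rangle$$ be the geodesic triangle group. For positive integers $d,k$ we write $H_d = H_k$ if the two groups are equal as quotients of the free group on $a,b,c$, that is, if the two sets of relators have the same normal closure in that free group (equivalently, if there is an isomorphism $H_d\to H_k$ with $a\mapsto a$, $b\mapsto b$, $c\mapsto c$). The group $H_d$ is called uncollapsed if $H_d\neq H_k$ for all integers $k$ with $1\le k<d$. Theorem. The group $H_{2^n}$ is uncollapsed for every integer $n\ge 3$, the group $H_{3^n}$ is uncollapsed for every integer $n\ge 2$, and the group $H_{5^n}$ is uncollapsed for every integer $n\ge 1$. -/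

import Mathlib

namespace GeodesicTriangle

/-- The names of the three generators of the geodesic triangle groups. -/
inductive Gen : Type
  | a
  | b
  | c

/-- The relators `a², b², c², (ab)³, (ac)², (bc)^d, (bac)^d` in the free group on `a, b, c`. -/
def relators (d : ℕ) : Set (FreeGroup Gen) :=
  let a : FreeGroup Gen := FreeGroup.of Gen.a
  let b : FreeGroup Gen := FreeGroup.of Gen.b
  let c : FreeGroup Gen := FreeGroup.of Gen.c
  {a ^ 2, b ^ 2, c ^ 2, (a * b) ^ 3, (a * c) ^ 2, (b * c) ^ d, (b * a * c) ^ d}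

/-- The geodesic triangle group
`H_d = ⟨a, b, c ∣ a², b², c², (ab)³, (ac)², (bc)^d, (bac)^d⟩`. -/
abbrev H (d : ℕ) : Type := PresentedGroup (relators d)

/-- `H_d = H_k` as groups with distinguished generators `a, b, c`, that is, as quotients of the
free group on `a, b, c`: there is an isomorphism between them that takes each of the three
generators to the generator of the same name. -/
def SameGroup (d k : ℕ) : Prop :=
  ∃ e : H d ≃* H k, ∀ x : Gen, e (PresentedGroup.of x) = PresentedGroup.of x

/-- `H_d` is uncollapsed if `H_d ≠ H_k` for all `1 ≤ k < d`. -/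
def Uncollapsed (d : ℕ) : Prop :=
  ∀ k : ℕ, 1 ≤ k → k < d → ¬ SameGroup d k

end GeodesicTriangle

/-!
The relators `a², b², c², (ab)³, (ac)²` present `PGL₂(ℤ)`, so quotients of `H d` are looked for
inside groups `PGL₂(R)`.  If `d = p ^ (n + 1)` and `A, B, C ∈ GL₂(R)` satisfy the relators of `H d`
up to scalars while `(BC) ^ p ^ n` is not scalar, then `bc` has order exactly `p ^ (n + 1)` in `H d`,
whereas an equality `H d = H k` forces `(bc) ^ k = 1`; this is `uncollapsed_of_matrices`.

For `p = 5` the standard generators of `PGL₂(ℤ)` reduced modulo `5 ^ n` do: `bc` is a transvection,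
and `bac` satisfies `X² = X + 1`, so that the entries of its powers are Fibonacci numbers up to sign
and the `5 ^ n`-th power is scalar because `5 ^ n` divides the `5 ^ n`-th Fibonacci number.

For `p = 2, 3` one deforms this representation.  Over an algebraically closed field there is a
representation in which `bc` has eigenvalue ratio `ζ` and `bac` has eigenvalue ratio `ω` as soon as
`ζ + ζ⁻¹ + ω + ω⁻¹ = -1`.  Take `ω = ζ = α`, that is `2α² + α + 2 = 0`.  It remains to choose the
characteristic `ℓ` in such a way that `α` is a root of unity of order exactly `p ^ n`.  The numbers
`V m = 2 ^ m (α ^ m + α⁻¹ ^ m)` form an integral Lucas sequence, and it suffices that `ℓ` divides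
`V (2 ^ (n - 2))`, which gives `α ^ 2 ^ (n - 1) = -1`, or `V m + 2 ^ m` with `m = 3 ^ (n - 1)`, which
makes `α ^ m` a primitive cube root of unity.  For `n ≥ 3`, respectively `n ≥ 2`, these integers are
`17` and `19` modulo 24, so each of them has a prime divisor, and it is different from 2 and 3.
-/

namespace GeodesicTriangle

open Matrix

/-! ### Detecting uncollapsed groups in projective linear groups -/

/-- If some group contains elements that satisfy the relators of `H (p ^ (n + 1))` and `bc` does not
have order dividing `p ^ n` there, then `bc` has order `p ^ (n + 1)`, and no smaller exponent gives
the same quotient of the free group. -/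
theorem uncollapsed_of_group {G : Type*} [Group G] {p n : ℕ} (hp : p.Prime) (a b c : G)
    (ha : a ^ 2 = 1) (hb : b ^ 2 = 1) (hc : c ^ 2 = 1) (hab : (a * b) ^ 3 = 1)
    (hac : (a * c) ^ 2 = 1) (hbc : (b * c) ^ p ^ (n + 1) = 1)
    (hbac : (b * a * c) ^ p ^ (n + 1) = 1) (hne : (b * c) ^ p ^ n ≠ 1) :
    Uncollapsed (p ^ (n + 1)) := by
  rintro k hk hlt ⟨e, he⟩
  let f : Gen → G
    | Gen.a => a
    | Gen.b => b
    | Gen.c => c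
  have hrel : ∀ r ∈ relators (p ^ (n + 1)), FreeGroup.lift f r = 1 := by
    intro r hr
    simp only [relators, Set.mem_insert_iff, Set.mem_singleton_iff] at hr
    rcases hr with rfl | rfl | rfl | rfl | rfl | rfl | rfl <;> simpa [f]
  let φ : H (p ^ (n + 1)) →* G := PresentedGroup.toGroup hrel
  have hHk : (PresentedGroup.of Gen.b * PresentedGroup.of Gen.c : H k) ^ k = 1 :=
    PresentedGroup.one_of_mem (rels := relators k)
      (x := (FreeGroup.of Gen.b * FreeGroup.of Gen.c) ^ k) (by simp [relators])
  have hHd : (PresentedGroup.of Gen.b * PresentedGroup.of Gen.c : H (p ^ (n + 1))) ^ k = 1 := by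
    apply e.injective
    simpa [he] using hHk
  have hG : (b * c) ^ k = 1 := by
    have h := congrArg φ hHd
    simpa [φ, f] using h
  have := Fact.mk hp
  have hdvd := orderOf_dvd_of_pow_eq_one hG
  rw [orderOf_eq_prime_pow hne hbc] at hdvd
  exact absurd (Nat.le_of_dvd hk hdvd) (not_le.mpr hlt)

/-- The previous criterion in `PGL₂(R)`: a matrix is trivial there when it is scalar. -/
theorem uncollapsed_of_matrices {R : Type*} [CommRing R] {p n : ℕ} (hp : p.Prime)
    (A B C : Matrix (Fin 2) (Fin 2) R)
    (hA : IsUnit A.det) (hB : IsUnit B.det) (hC : IsUnit C.det)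
    (ha : A ^ 2 ∈ Set.range (scalar (Fin 2))) (hb : B ^ 2 ∈ Set.range (scalar (Fin 2)))
    (hc : C ^ 2 ∈ Set.range (scalar (Fin 2))) (hab : (A * B) ^ 3 ∈ Set.range (scalar (Fin 2)))
    (hac : (A * C) ^ 2 ∈ Set.range (scalar (Fin 2)))
    (hbc : (B * C) ^ p ^ (n + 1) ∈ Set.range (scalar (Fin 2)))
    (hbac : (B * A * C) ^ p ^ (n + 1) ∈ Set.range (scalar (Fin 2)))
    (hne : (B * C) ^ p ^ n ∉ Set.range (scalar (Fin 2))) :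
    Uncollapsed (p ^ (n + 1)) := by
  have key : ∀ g : GL (Fin 2) R, ProjGenLinGroup.mk g = 1 ↔
      (g : Matrix (Fin 2) (Fin 2) R) ∈ Set.range (scalar (Fin 2)) := fun g =>
    ProjGenLinGroup.mk_eq_one.trans GeneralLinearGroup.mem_center_iff_val_mem_range_scalar
  let a := GeneralLinearGroup.mk'' A hA
  let b := GeneralLinearGroup.mk'' B hB
  let c := GeneralLinearGroup.mk'' C hC
  apply uncollapsed_of_group hp (ProjGenLinGroup.mk a) (ProjGenLinGroup.mk b)
    (ProjGenLinGroup.mk c) <;> simp only [← map_mul, ← map_pow, Ne, key] <;> assumption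

/-! ### Exponents that are powers of five -/

/-- For `X² = X + 1` the coefficient of `X` in `X ^ 5 ^ k` is divisible by `5 ^ k`. -/
theorem exists_pow_five_pow_eq {R : Type*} [Ring R] {X : R} (hX : X ^ 2 = X + 1) (k : ℕ) :
    ∃ p q : ℤ, X ^ 5 ^ k = p + (5 ^ k * q : ℤ) * X := by
  induction k with
  | zero => exact ⟨0, 1, by simp⟩
  | succ k ih =>
    obtain ⟨p, q, h⟩ := ih
    have hmul : ∀ r s t u : ℤ, ((r : R) + s * X) * (t + u * X)
        = ((r * t + s * u : ℤ) : R) + ((r * u + s * t + s * u : ℤ) : R) * X := by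
      intro r s t u
      have h1 : (s : R) * X * (u * X) = ((s * u : ℤ) : R) * X ^ 2 := by
        rw [mul_assoc, ← mul_assoc X, ← (Int.cast_commute u X).eq, mul_assoc, ← sq, ← mul_assoc]
        push_cast
        rfl
      have h2 : (s : R) * X * t = ((s * t : ℤ) : R) * X := by
        rw [mul_assoc, ← (Int.cast_commute t X).eq, ← mul_assoc]
        push_cast
        rfl
      rw [add_mul, mul_add, mul_add, h1, h2, hX, ← mul_assoc]
      push_cast
      noncomm_ring
    -- expand `(p + vX)⁵` with `v = 5 ^ k q`; its coefficient of `X` is divisible by `5v`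
    set v : ℤ := 5 ^ k * q with hv
    refine ⟨p ^ 5 + 10 * p ^ 3 * v ^ 2 + 10 * p ^ 2 * v ^ 3 + 10 * p * v ^ 4 + 3 * v ^ 5,
      q * (p ^ 4 + 2 * p ^ 3 * v + 4 * p ^ 2 * v ^ 2 + 3 * p * v ^ 3 + v ^ 4), ?_⟩
    rw [pow_succ 5 k, pow_mul, h, pow_succ, pow_succ, pow_succ, sq]
    simp only [hmul]
    congr 2
    · ring
    · congr 1
      rw [pow_succ, hv]
      ring

theorem uncollapsed_five_pow (n : ℕ) : Uncollapsed (5 ^ (n + 1)) := by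
  have hT : ∀ k : ℕ, (!![1, 1; 0, -1] * !![1, 0; 0, -1] : Matrix (Fin 2) (Fin 2)
      (ZMod (5 ^ (n + 1)))) ^ k = !![1, -(k : ZMod (5 ^ (n + 1))); 0, 1] := by
    intro k
    induction k with
    | zero => simp [one_fin_two]
    | succ k ih =>
      rw [pow_succ _ k, ih]
      ext i j
      fin_cases i <;> fin_cases j <;> simp [mul_apply, Fin.sum_univ_two]
  apply uncollapsed_of_matrices (R := ZMod (5 ^ (n + 1))) Nat.prime_five !![0, 1; 1, 0]
    !![1, 1; 0, -1] !![1, 0; 0, -1]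
  · simp [det_fin_two]
  · simp [det_fin_two]
  · simp [det_fin_two]
  · refine ⟨1, ?_⟩
    ext i j
    fin_cases i <;> fin_cases j <;> simp [sq, mul_apply, Fin.sum_univ_two]
  · refine ⟨1, ?_⟩
    ext i j
    fin_cases i <;> fin_cases j <;> simp [sq, mul_apply, Fin.sum_univ_two]
  · refine ⟨1, ?_⟩
    ext i j
    fin_cases i <;> fin_cases j <;> simp [sq, mul_apply, Fin.sum_univ_two]
  · refine ⟨-1, ?_⟩
    ext i j
    fin_cases i <;> fin_cases j <;> simp [pow_succ, mul_apply, Fin.sum_univ_two]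
  · refine ⟨-1, ?_⟩
    ext i j
    fin_cases i <;> fin_cases j <;> simp [sq, mul_apply, Fin.sum_univ_two]
  · refine ⟨1, ?_⟩
    rw [hT, ZMod.natCast_self]
    simp [one_fin_two]
  · obtain ⟨p, q, h⟩ := exists_pow_five_pow_eq (X := (!![1, 1; 0, -1] * !![0, 1; 1, 0] *
      !![1, 0; 0, -1] : Matrix (Fin 2) (Fin 2) (ZMod (5 ^ (n + 1))))) (by
        ext i j
        fin_cases i <;> fin_cases j <;> simp [sq, mul_apply, Fin.sum_univ_two, one_apply])
      (n + 1)
    have h0 : ((5 ^ (n + 1) : ℤ) : Matrix (Fin 2) (Fin 2) (ZMod (5 ^ (n + 1)))) = 0 := by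
      have h5 : ((5 ^ (n + 1) : ℤ) : ZMod (5 ^ (n + 1))) = 0 := by
        exact_mod_cast ZMod.natCast_self (5 ^ (n + 1))
      have h := map_intCast (scalar (Fin 2) : ZMod (5 ^ (n + 1)) →+* _) (5 ^ (n + 1))
      rw [← h, h5, map_zero]
    refine ⟨p, ?_⟩
    rw [h, Int.cast_mul, h0, zero_mul, zero_mul, add_zero, map_intCast]
  · rintro ⟨r, hr⟩
    rw [hT] at hr
    have h := congrFun (congrFun hr 0) 1
    have h5 : ((5 ^ n : ℕ) : ZMod (5 ^ (n + 1))) = 0 := by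
      simpa using h.symm
    rw [ZMod.natCast_eq_zero_iff] at h5
    have := (Nat.pow_dvd_pow_iff_le_right (by norm_num : 1 < 5)).mp h5
    omega

/-! ### A Lucas sequence -/

/-- The Lucas sequence `V₀ = 2`, `V₁ = -1`, `Vₘ₊₂ = -Vₘ₊₁ - 4Vₘ`, whose `m`-th term is the sum of
the `m`-th powers of the roots of `x² + x + 4`. -/
def lucasV : ℕ → ℤ
  | 0 => 2
  | 1 => -1
  | m + 2 => -lucasV (m + 1) - 4 * lucasV m

theorem lucasV_emod (k : ℕ) : lucasV (2 * k + 2) % 24 = 17 ∧ lucasV (2 * k + 3) % 24 = 11 := by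
  induction k with
  | zero => decide
  | succ k ih =>
    have h1 : lucasV (2 * (k + 1) + 2) = -lucasV (2 * k + 3) - 4 * lucasV (2 * k + 2) := rfl
    have h2 : lucasV (2 * (k + 1) + 3) = -lucasV (2 * (k + 1) + 2) - 4 * lucasV (2 * k + 3) := rfl
    omega

/-- The roots of `2x² + x + 2` are `α` and `α⁻¹`, those of `x² + x + 4` are `2α` and `2α⁻¹`. -/
theorem pow_mul_lucasV {K : Type*} [CommRing K] {α : K} (hα : 2 * α ^ 2 + α + 2 = 0) (m : ℕ) :
    α ^ m * lucasV m = 2 ^ m * (α ^ (2 * m) + 1) := by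
  have h : α ^ m * lucasV m = 2 ^ m * (α ^ (2 * m) + 1) ∧
      α ^ (m + 1) * lucasV (m + 1) = 2 ^ (m + 1) * (α ^ (2 * (m + 1)) + 1) := by
    induction m with
    | zero =>
      simp only [lucasV]
      push_cast
      constructor
      · ring
      · linear_combination -hα
    | succ m ih =>
      refine ⟨ih.2, ?_⟩
      have h1 : lucasV (m + 2) = -lucasV (m + 1) - 4 * lucasV m := rfl
      rw [show m + 1 + 1 = m + 2 from rfl, h1]
      push_cast
      linear_combination (-α) * ih.2 - 4 * α ^ 2 * ih.1
        - 2 ^ (m + 1) * (α ^ (2 * (m + 1)) + 1) * hα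
  exact h.1

/-- An integer that is `17` or `19` modulo `24` is not `±1` and is prime to `6`. -/
theorem exists_prime_dvd_of_emod {N : ℤ} (hN : N % 24 = 17 ∨ N % 24 = 19) :
    ∃ l : ℕ, l.Prime ∧ (l : ℤ) ∣ N ∧ l ≠ 2 ∧ l ≠ 3 := by
  obtain ⟨l, hl, hd⟩ := Nat.exists_prime_and_dvd (n := N.natAbs) (by omega)
  have hd' : (l : ℤ) ∣ N := Int.natCast_dvd.mpr hd
  refine ⟨l, hl, hd', ?_, ?_⟩
  · rintro rfl
    push_cast at hd'
    omega
  · rintro rfl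
    push_cast at hd'
    omega

/-! ### Representations with prescribed eigenvalue ratio -/

/-- Powers of an element annihilated by `(x - r)(x - s)`. -/
theorem sub_smul_pow {K S : Type*} [CommRing K] [Ring S] [Algebra K S] {X : S} {r s : K}
    (hX : X ^ 2 = (r + s) • X - (r * s) • (1 : S)) (k : ℕ) :
    (r - s) • X ^ k = (r ^ k - s ^ k) • X + (r * s ^ k - s * r ^ k) • (1 : S) := by
  induction k with
  | zero => simp
  | succ k ih =>
    rw [pow_succ, ← smul_mul_assoc, ih, add_mul, smul_mul_assoc, ← sq, hX, smul_mul_assoc, one_mul]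
    module

/-- A power of a matrix with two distinct eigenvalues is scalar if the powers of the eigenvalues
agree. -/
theorem pow_mem_range_scalar {K : Type*} [Field K] {X : Matrix (Fin 2) (Fin 2) K} {r s : K}
    (hrs : r ≠ s) (hX : X ^ 2 = (r + s) • X - (r * s) • 1) {k : ℕ}
    (hk : r ^ k = s ^ k) : X ^ k ∈ Set.range (scalar (Fin 2)) := by
  have h := sub_smul_pow hX k
  rw [hk, sub_self, zero_smul, zero_add] at h
  refine ⟨(r - s)⁻¹ * (r * s ^ k - s * s ^ k), ?_⟩
  rw [← inv_smul_smul₀ (sub_ne_zero.mpr hrs) (X ^ k), h, smul_smul, scalar_apply,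
    smul_one_eq_diagonal]

/-- The converse of `pow_mem_range_scalar` holds as soon as `X` is not diagonal. -/
theorem pow_eq_pow_of_pow_mem_range_scalar {K : Type*} [Field K] {X : Matrix (Fin 2) (Fin 2) K}
    {r s : K} (hX : X ^ 2 = (r + s) • X - (r * s) • 1) {i j : Fin 2} (hij : i ≠ j)
    (hne : X i j ≠ 0) {k : ℕ} (hk : X ^ k ∈ Set.range (scalar (Fin 2))) : r ^ k = s ^ k := by
  obtain ⟨t, ht⟩ := hk
  have h := congrFun (congrFun (sub_smul_pow hX k) i) j
  rw [← ht] at h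
  simp [hij, hne] at h
  exact sub_eq_zero.mp h

/-- Over an algebraically closed field, a root `α` of `2x² + x + 2` gives matrices satisfying the
relators of the triangle group for which both `bc` and `bac` have eigenvalue ratio `α`; hence it is
enough that `α` is a root of unity of order `p ^ (n + 1)`. -/
theorem uncollapsed_of_root {K : Type*} [Field K] [IsAlgClosed K] (h2 : (2 : K) ≠ 0)
    (h3 : (3 : K) ≠ 0) {α : K} (hα : 2 * α ^ 2 + α + 2 = 0) {p n : ℕ} (hp : p.Prime)
    (h1 : α ^ p ^ (n + 1) = 1) (hne : α ^ p ^ n ≠ 1) : Uncollapsed (p ^ (n + 1)) := by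
  obtain ⟨i, hi⟩ := IsAlgClosed.exists_pow_nat_eq (-1 : K) (n := 2) (by norm_num)
  obtain ⟨s, hs⟩ := IsAlgClosed.exists_pow_nat_eq (6 : K) (n := 2) (by norm_num)
  have hi0 : i ≠ 0 := by
    rintro rfl
    norm_num at hi
  have hα1 : α ≠ 1 := by
    rintro rfl
    simp at hne
  have hα' : 1 + α ≠ 0 := by
    intro h
    apply h3
    linear_combination hα - (2 * α - 1) * h
  -- the eigenvalues of `bc`, which have sum `6` and product `24`, are `α * m` and `m`
  obtain ⟨m, hm⟩ : ∃ m : K, m * (1 + α) = 6 := ⟨6 / (1 + α), by field_simp⟩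
  have hm0 : m ≠ 0 := by
    rintro rfl
    have h6 : (2 : K) * 3 = 0 := by linear_combination -hm
    exact (mul_ne_zero h2 h3) h6
  have hsum : α * m + m = 6 := by linear_combination hm
  have hprod : α * m * m = 24 := by
    have h : (3 : K) * (α * m * m - 24) = 0 := by
      linear_combination (2 * (m * (1 + α)) + 12) * hm - m ^ 2 * hα
    exact sub_eq_zero.mp ((mul_eq_zero.mp h).resolve_left h3)
  have hmα : α * m ≠ m := fun h => hα1 (mul_right_cancel₀ hm0 (h.trans (one_mul m).symm))
  have h24 : (24 : K) ≠ 0 := by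
    have : (24 : K) = 2 * 2 * 2 * 3 := by norm_num
    rw [this]
    simp [h2, h3]
  -- the off-diagonal entries `y, z` of the matrix of `b` solve `(y + z)² = 24` and `(y - z)² = -36`,
  -- which are the conditions that `ab` have order 3 and that `bac` be `i` times a matrix of trace
  -- `6` and determinant `24`
  have hbc : (!![3, s + 3 * i; s - 3 * i, -3] * !![1, 0; 0, -1] : Matrix (Fin 2) (Fin 2) K) ^ 2 =
      (α * m + m) • (!![3, s + 3 * i; s - 3 * i, -3] * !![1, 0; 0, -1]) - (α * m * m) • 1 := by
    rw [hsum, hprod]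
    ext u v
    fin_cases u <;> fin_cases v <;>
      simp [sq, mul_apply, Fin.sum_univ_two]
    all_goals first | linear_combination 9 * hi - hs | ring
  have hbac : (!![3, s + 3 * i; s - 3 * i, -3] * !![0, 1; 1, 0] * !![1, 0; 0, -1] :
      Matrix (Fin 2) (Fin 2) K) ^ 2 = (i * (α * m) + i * m) •
      (!![3, s + 3 * i; s - 3 * i, -3] * !![0, 1; 1, 0] * !![1, 0; 0, -1])
        - (i * (α * m) * (i * m)) • 1 := by
    rw [show i * (α * m) + i * m = i * 6 by linear_combination i * hsum,
      show i * (α * m) * (i * m) = -24 by linear_combination i ^ 2 * hprod + 24 * hi]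
    ext u v
    fin_cases u <;> fin_cases v <;>
      simp [sq, mul_apply, Fin.sum_univ_two]
    all_goals first | linear_combination hs - 9 * hi | ring
  apply uncollapsed_of_matrices hp !![0, 1; 1, 0] !![3, s + 3 * i; s - 3 * i, -3] !![1, 0; 0, -1]
  · simp [det_fin_two]
  · rw [isUnit_iff_ne_zero, det_fin_two_of]
    rw [show 3 * -3 - (s + 3 * i) * (s - 3 * i) = -24 by linear_combination 9 * hi - hs]
    exact neg_ne_zero.mpr h24
  · simp [det_fin_two]
  · refine ⟨1, ?_⟩
    ext u v
    fin_cases u <;> fin_cases v <;> simp [sq, mul_apply, Fin.sum_univ_two]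
  · refine ⟨24, ?_⟩
    ext u v
    fin_cases u <;> fin_cases v <;> simp [sq, mul_apply, Fin.sum_univ_two]
    all_goals first | linear_combination 9 * hi - hs | ring
  · refine ⟨1, ?_⟩
    ext u v
    fin_cases u <;> fin_cases v <;> simp [sq, mul_apply, Fin.sum_univ_two]
  · -- `ab` has trace `t = 2s` and determinant `24 = t²`, so its cube is `-t³ = -48s`
    refine ⟨-48 * s, ?_⟩
    ext u v
    fin_cases u <;> fin_cases v <;> simp [pow_succ, mul_apply, Fin.sum_univ_two]
    · linear_combination -(3 * hs + 9 * hi) * (s - 3 * i) + 2 * s * (hs - 9 * hi)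
    · linear_combination -(3 * hs + 9 * hi) * (-3)
    · linear_combination -(3 * hs + 9 * hi) * 3
    · linear_combination -(3 * hs + 9 * hi) * (s + 3 * i) + 2 * s * (hs - 9 * hi)
  · refine ⟨-1, ?_⟩
    ext u v
    fin_cases u <;> fin_cases v <;> simp [sq, mul_apply, Fin.sum_univ_two]
  · exact pow_mem_range_scalar hmα hbc (by rw [mul_pow, h1, one_mul])
  · refine pow_mem_range_scalar (fun h => hmα (mul_left_cancel₀ hi0 h)) hbac ?_
    rw [mul_pow, mul_pow, h1, one_mul, mul_pow]
  · intro h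
    have hoff : ∃ u v : Fin 2, u ≠ v ∧ (!![3, s + 3 * i; s - 3 * i, -3] * !![1, 0; 0, -1] :
        Matrix (Fin 2) (Fin 2) K) u v ≠ 0 := by
      by_contra! hcon
      have h01 := hcon 0 1 (by decide)
      have h10 := hcon 1 0 (by decide)
      simp [mul_apply, Fin.sum_univ_two] at h01 h10
      have : (2 : K) * 3 * i = 0 := by linear_combination -h01 - h10
      exact mul_ne_zero (mul_ne_zero h2 h3) hi0 this
    obtain ⟨u, v, huv, hX⟩ := hoff
    have hpow := pow_eq_pow_of_pow_mem_range_scalar hbc huv hX h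
    rw [mul_pow] at hpow
    exact hne (mul_right_cancel₀ (pow_ne_zero _ hm0) (hpow.trans (one_mul _).symm))

/-! ### Exponents that are powers of two and three -/

/-- An algebraically closed field in which a given integer that is `17` or `19` modulo `24` vanishes
but 2 and 3 do not, with a root of `2x² + x + 2`. -/
theorem exists_field_root {N : ℤ} (hN : N % 24 = 17 ∨ N % 24 = 19) :
    ∃ (K : Type) (_ : Field K) (_ : IsAlgClosed K) (α : K), (2 : K) ≠ 0 ∧ (3 : K) ≠ 0 ∧
      (N : K) = 0 ∧ 2 * α ^ 2 + α + 2 = 0 := by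
  obtain ⟨l, hl, hd, hl2, hl3⟩ := exists_prime_dvd_of_emod hN
  have := Fact.mk hl
  let K := AlgebraicClosure (ZMod l)
  have : CharP K l := charP_of_injective_algebraMap (algebraMap (ZMod l) K).injective l
  have h2 : (2 : K) ≠ 0 := by
    intro h
    have h' : l ∣ 2 := (CharP.cast_eq_zero_iff K l 2).mp (by exact_mod_cast h)
    exact hl2 ((Nat.prime_dvd_prime_iff_eq hl Nat.prime_two).mp h')
  have h3 : (3 : K) ≠ 0 := by
    intro h
    have h' : l ∣ 3 := (CharP.cast_eq_zero_iff K l 3).mp (by exact_mod_cast h)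
    exact hl3 ((Nat.prime_dvd_prime_iff_eq hl Nat.prime_three).mp h')
  obtain ⟨t, ht⟩ := IsAlgClosed.exists_pow_nat_eq (-15 : K) (n := 2) (by norm_num)
  obtain ⟨u, hu⟩ : ∃ u : K, 4 * u = 1 := by
    refine ⟨4⁻¹, mul_inv_cancel₀ ?_⟩
    rw [show (4 : K) = 2 * 2 by norm_num]
    exact mul_ne_zero h2 h2
  have hroot : 2 * ((t - 1) * u) ^ 2 + (t - 1) * u + 2 = 0 := by
    linear_combination 2 * u ^ 2 * ht + ((-7 - t) * u - 2) * hu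
  refine ⟨K, inferInstance, inferInstance, (t - 1) * u, h2, h3,
    (CharP.intCast_eq_zero_iff K l N).mpr hd, hroot⟩

theorem uncollapsed_two_pow (n : ℕ) : Uncollapsed (2 ^ (n + 3)) := by
  have hN : lucasV (2 ^ (n + 1)) % 24 = 17 := by
    have h := (lucasV_emod (2 ^ n - 1)).1
    rwa [show 2 * (2 ^ n - 1) + 2 = 2 ^ (n + 1) by have := Nat.one_le_two_pow (n := n); omega] at h
  obtain ⟨K, _, _, α, h2, h3, hN0, hα⟩ := exists_field_root (Or.inl hN)
  have hm := pow_mul_lucasV hα (2 ^ (n + 1))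
  rw [hN0, mul_zero] at hm
  have hpow : α ^ 2 ^ (n + 2) = -1 := by
    rw [pow_succ 2 (n + 1), mul_comm]
    have := (mul_eq_zero.mp hm.symm).resolve_left (pow_ne_zero _ h2)
    linear_combination this
  apply uncollapsed_of_root h2 h3 hα Nat.prime_two
  · rw [pow_succ 2 (n + 2), pow_mul, hpow]
    norm_num
  · rw [hpow]
    intro h
    exact h2 (by linear_combination -h)

theorem uncollapsed_three_pow (n : ℕ) : Uncollapsed (3 ^ (n + 2)) := by
  obtain ⟨k, hk⟩ : ∃ k, 3 ^ (n + 1) = 2 * k + 3 := by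
    have hodd : Odd (3 ^ (n + 1)) := Odd.pow (by decide)
    obtain ⟨j, hj⟩ := hodd
    have hle : 3 ^ 1 ≤ 3 ^ (n + 1) := Nat.pow_le_pow_right (by norm_num) (by omega)
    exact ⟨j - 1, by omega⟩
  have hN : (lucasV (2 * k + 3) + 2 ^ (2 * k + 3)) % 24 = 19 := by
    have h := (lucasV_emod k).2
    have h8 : ∀ j : ℕ, (2 ^ (2 * j + 3) : ℤ) % 24 = 8 := by
      intro j
      induction j with
      | zero => norm_num
      | succ j ih =>
        rw [show 2 * (j + 1) + 3 = 2 * j + 3 + 2 by ring, pow_add]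
        omega
    have := h8 k
    omega
  obtain ⟨K, _, _, α, h2, h3, hN0, hα⟩ := exists_field_root (Or.inr hN)
  have hm := pow_mul_lucasV hα (2 * k + 3)
  rw [← hk] at hm hN0
  set y := α ^ 3 ^ (n + 1) with hy
  -- `y` is a primitive cube root of unity
  have hcyc : y ^ 2 + y + 1 = 0 := by
    have h : (2 : K) ^ 3 ^ (n + 1) * (y ^ 2 + y + 1) = 0 := by
      push_cast at hN0
      rw [mul_comm 2 (3 ^ (n + 1)), pow_mul, ← hy] at hm
      linear_combination -hm + y * hN0
    exact (mul_eq_zero.mp h).resolve_left (pow_ne_zero _ h2)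
  apply uncollapsed_of_root h2 h3 hα Nat.prime_three
  · rw [pow_succ 3 (n + 1), pow_mul, ← hy]
    linear_combination (y - 1) * hcyc
  · rw [← hy]
    intro h
    rw [h] at hcyc
    exact h3 (by linear_combination hcyc)

end GeodesicTriangle

theorem mainTheorem3 :
    (∀ n : ℕ, 3 ≤ n → GeodesicTriangle.Uncollapsed (2 ^ n)) ∧
    (∀ n : ℕ, 2 ≤ n → GeodesicTriangle.Uncollapsed (3 ^ n)) ∧
    (∀ n : ℕ, 1 ≤ n → GeodesicTriangle.Uncollapsed (5 ^ n)) := by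
  refine ⟨fun n hn => ?_, fun n hn => ?_, fun n hn => ?_⟩
  · obtain ⟨k, rfl⟩ := Nat.exists_eq_add_of_le' hn
    exact GeodesicTriangle.uncollapsed_two_pow k
  · obtain ⟨k, rfl⟩ := Nat.exists_eq_add_of_le' hn
    exact GeodesicTriangle.uncollapsed_three_pow k
  · obtain ⟨k, rfl⟩ := Nat.exists_eq_add_of_le' hn
    exact GeodesicTriangle.uncollapsed_five_pow k
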